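/- Let $f=a_0x^3+3a_1x^2y+3a_2xy^2+a_3y^3$ be the generic binary cubic over $\mathbb C$. A covariant of degree $n$ and order $e$ of binary cubics is a polynomial $\Phi\in\mathbb C[a_0,\dots,a_3][x,y]$, homogeneous of degree $n$ in $a_0,\dots,a_3$ and of degree $e$ in $x,y$, such that the polynomial map $h\mapsto\Phi(h)$ from binary cubics to binary forms of degree $e$ is $SL(2,\mathbb C)$-equivariant: $\Phi(h\circ g)=\Phi(h)\circ g$ for all cubics $h$ and all $g\in SL(2,\mathbb C)$. The algebra of covariants $\mathrm{Cov}=\bigoplus_{n,e}\mathrm{Cov}_{n,e}\subset\mathbb C[a_0,\dots,a_3][x,y]$ is the sum of the spaces $\mathrm{Cov}_{n,e}$ of covariants of degree $n$ and order $e$. Put $$\Delta=4(a_0a_2-a_1^2)(a_1a_3-a_2^2)-(a_0a_3-a_1a_2)^2,\qquad H=\tfrac1{36}\left(f_{xx}f_{yy}-f_{xy}^2\right),\qquad Q=(f,H)_1=f_xH_y-f_yH_x .$$ Theorem. The algebra $\mathrm{Cov}$ is generated over $\mathbb C$ by $\Delta$, $H$, $f$ and $Q$. These satisfy $$36H^3+9\Delta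 f^2+Q^2=0,$$ and this is the single relation among them: the kernel of the $\mathbb C$-algebra homomorphism $\mathbb C[T_0,T_1,T_2,T_3]\to\mathbb C[a_0,\dots,a_3][x,y]$, $T_0\mapsto\Delta$, $T_1\mapsto H$, $T_2\mapsto f$, $T_3\mapsto Q$, is the ideal generated by $36T_1^3+9T_0T_2^2+T_3^2$. -/

import Mathlib

open MvPolynomial

noncomputable section

namespace BinaryCovariant

/-- The binary form `∑ i, (d choose i) a_i x^(d-i) y^i` of degree `d` with coefficients `a`,
where `x = X 0` and `y = X 1`. -/
def binaryForm {R : Type*} [CommRing R] (d : ℕ) (a : Fin (d + 1) → R) :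
    MvPolynomial (Fin 2) R :=
  ∑ i : Fin (d + 1), C ((d.choose i : R) * a i) * X 0 ^ (d - (i : ℕ)) * X 1 ^ (i : ℕ)

/-- Polynomials in `x, y` whose coefficients are polynomials in the coefficients
`a_0, …, a_d` of a binary form of degree `d`. -/
abbrev FormRing (d : ℕ) : Type := MvPolynomial (Fin 2) (MvPolynomial (Fin (d + 1)) ℂ)

/-- The generic binary form of degree `d`; its coefficients are the variables `a_0, …, a_d`. -/
def genericForm (d : ℕ) : FormRing d := binaryForm d X

/-- The value `Φ(a; x, y)` of `Φ` at a coefficient vector `a`, a polynomial in `x, y`. -/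
def specialize {d : ℕ} (a : Fin (d + 1) → ℂ) : FormRing d →+* MvPolynomial (Fin 2) ℂ :=
  MvPolynomial.map (MvPolynomial.eval a)

/-- The linear substitution `F ↦ F ∘ g` on polynomials in two variables. -/
def substitute (g : Matrix.SpecialLinearGroup (Fin 2) ℂ) :
    MvPolynomial (Fin 2) ℂ →ₐ[ℂ] MvPolynomial (Fin 2) ℂ :=
  aeval fun i => ∑ j, C (g.1 i j) * X j

/-- `Φ`, seen as a polynomial map from binary forms of degree `d` to polynomials in `x, y`,
is `SL(2)`-equivariant: `Φ(f ∘ g) = Φ(f) ∘ g` for every form `f` (with coefficients `a`)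
and every `g`; here `b` is the coefficient vector of `f ∘ g`. -/
def IsEquivariant {d : ℕ} (Φ : FormRing d) : Prop :=
  ∀ (g : Matrix.SpecialLinearGroup (Fin 2) ℂ) (a b : Fin (d + 1) → ℂ),
    binaryForm d b = substitute g (binaryForm d a) →
      specialize b Φ = substitute g (specialize a Φ)

/-- The space of covariants of degree `n` and order `e` of binary forms of degree `d`:
the `SL(2)`-equivariant polynomial maps, homogeneous of degree `n`, from binary forms of
degree `d` to binary forms of degree `e`. -/
def covariants (d n e : ℕ) : Submodule ℂ (FormRing d) where
  carrier := {Φ | Φ.IsHomogeneous e ∧ (∀ m, (Φ.coeff m).IsHomogeneous n) ∧ IsEquivariant Φ}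
  add_mem' := by
    rintro Φ Ψ ⟨h1, h2, h3⟩ ⟨k1, k2, k3⟩
    refine ⟨h1.add k1, fun m => ?_, fun g a b h => ?_⟩
    · rw [coeff_add]; exact (h2 m).add (k2 m)
    · rw [map_add, map_add, map_add, h3 g a b h, k3 g a b h]
  zero_mem' := by
    refine ⟨isHomogeneous_zero _ _ _, fun m => ?_, fun g a b h => ?_⟩
    · rw [coeff_zero]; exact isHomogeneous_zero _ _ _
    · simp
  smul_mem' := by
    rintro c Φ ⟨h1, h2, h3⟩
    have e1 : c • Φ = C (C c) * Φ := by
      rw [C_mul', ← algebraMap_eq, algebraMap_smul]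
    rw [e1]
    refine ⟨by simpa using (isHomogeneous_C (Fin 2) (C c)).mul h1, fun m => ?_, fun g a b h => ?_⟩
    · rw [coeff_C_mul]; simpa using (isHomogeneous_C _ c).mul (h2 m)
    · have := h3 g a b h
      rw [map_mul, map_mul, map_mul, this]
      simp [specialize, substitute]

theorem one_mem_covariants (d : ℕ) : (1 : FormRing d) ∈ covariants d 0 0 := by
  refine ⟨isHomogeneous_one _ _, fun m => ?_, fun g a b h => by simp⟩
  rw [coeff_one]
  split_ifs
  · exact isHomogeneous_one _ _
  · exact isHomogeneous_zero _ _ _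

theorem mul_mem_covariants {d n e n' e' : ℕ} {Φ Ψ : FormRing d}
    (hΦ : Φ ∈ covariants d n e) (hΨ : Ψ ∈ covariants d n' e') :
    Φ * Ψ ∈ covariants d (n + n') (e + e') := by
  obtain ⟨h1, h2, h3⟩ := hΦ
  obtain ⟨k1, k2, k3⟩ := hΨ
  refine ⟨h1.mul k1, fun m => ?_, fun g a b h => ?_⟩
  · rw [coeff_mul]
    exact IsHomogeneous.sum _ _ _ fun p _ => (h2 p.1).mul (k2 p.2)
  · rw [map_mul, map_mul, map_mul, h3 g a b h, k3 g a b h]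

/-- The algebra of covariants of binary forms of degree `d`: the sum, over all degrees `n`
and orders `e`, of the spaces of covariants of degree `n` and order `e`. -/
def covariantAlgebra (d : ℕ) : Subalgebra ℂ (FormRing d) :=
  (⨆ p : ℕ × ℕ, covariants d p.1 p.2).toSubalgebra
    (Submodule.mem_iSup_of_mem (0, 0) (one_mem_covariants d))
    (by
      intro Φ Ψ hΦ hΨ
      induction hΦ using Submodule.iSup_induction' with
      | mem p Φ hΦ =>
        induction hΨ using Submodule.iSup_induction' with
        | mem q Ψ hΨ =>
          exact Submodule.mem_iSup_of_mem (p.1 + q.1, p.2 + q.2) (mul_mem_covariants hΦ hΨ)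
        | zero => rw [mul_zero]; exact Submodule.zero_mem _
        | add A B _ _ hA hB => rw [mul_add]; exact Submodule.add_mem _ hA hB
      | zero => rw [zero_mul]; exact Submodule.zero_mem _
      | add A B _ _ hA hB => rw [add_mul]; exact Submodule.add_mem _ hA hB)

/-- The `n`-th transvectant
`(F, G)_n = ∑ i ≤ n, (-1)^i (n choose i) (∂^n F / ∂x^(n-i) ∂y^i) (∂^n G / ∂x^i ∂y^(n-i))`. -/
def transvectant {R : Type*} [CommRing R] (n : ℕ) (F G : MvPolynomial (Fin 2) R) :
    MvPolynomial (Fin 2) R :=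
  ∑ i ∈ Finset.range (n + 1), (-1) ^ i * (n.choose i : MvPolynomial (Fin 2) R) *
    ((⇑(pderiv 0))^[n - i] ((⇑(pderiv 1))^[i] F)) *
    ((⇑(pderiv 0))^[i] ((⇑(pderiv 1))^[n - i] G))

/-- The generic binary cubic `f = a_0 x^3 + 3 a_1 x^2 y + 3 a_2 x y^2 + a_3 y^3`. -/
def cubic : FormRing 3 := genericForm 3

/-- The normalized Hessian `H = (f_xx f_yy - f_xy^2) / 36` of the generic binary cubic. -/
def hessian : FormRing 3 :=
  (1 / 36 : ℂ) • (pderiv 0 (pderiv 0 cubic) * pderiv 1 (pderiv 1 cubic)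
    - pderiv 0 (pderiv 1 cubic) ^ 2)

/-- The covariant `Q = (f, H)_1`. -/
def covariantQ : FormRing 3 := transvectant 1 cubic hessian

/-- The normalized discriminant
`Δ = 4 (a_0 a_2 - a_1^2) (a_1 a_3 - a_2^2) - (a_0 a_3 - a_1 a_2)^2`. -/
def discriminant : FormRing 3 :=
  C (4 * (X 0 * X 2 - X 1 ^ 2) * (X 1 * X 3 - X 2 ^ 2) - (X 0 * X 3 - X 1 * X 2) ^ 2)

end BinaryCovariant

end

namespace BinaryCovariant

/-! ### Explicit formulas -/

/-! A covariant is determined by its source, its value at `(x, y) = (1, 0)`, because `SL(2)` carries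
`(1, 0)` to every `v` with `v 0 ≠ 0` (`IsEquivariant.eq_of_source_eq`). So it is enough to write the
source of a covariant as a polynomial in the sources of `Δ`, `H`, `f`, `Q`.

The source is invariant under shears. Where `a₀ ≠ 0`, a shear makes `a₁` vanish, and the remaining
coefficients are fractions in the sources of `H`, `f`, `Q` with powers of `a₀` as denominators.
Hence some `a₀ ^ k` times the source is such a polynomial, and the factors `a₀` are removed one at a
time (`exists_eval_sourceValue_of_mul`).

That removal and the computation of the kernel share one argument. Modulo the relation, which is
monic in `T₃`, a polynomial has the form `A + T₃ B`. If it vanishes at two opposite nonzero values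
`±q` of `T₃`, then `A` and `B` both vanish there. The source map reaches every point of the
hypersurface with `t ≠ 0`, and, from `a₀ = 0`, every point with `t = 0` and `h ≠ 0`. -/

theorem binaryForm_three {R : Type*} [CommRing R] (a : Fin 4 → R) :
    binaryForm 3 a = C (a 0) * X 0 ^ 3 + C (3 * a 1) * X 0 ^ 2 * X 1
      + C (3 * a 2) * X 0 * X 1 ^ 2 + C (a 3) * X 1 ^ 3 := by
  simp [binaryForm, Fin.sum_univ_four]
  rw [map_ofNat]

theorem cubic_eq : cubic = C (X 0) * X 0 ^ 3 + 3 * C (X 1) * X 0 ^ 2 * X 1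
    + 3 * C (X 2) * X 0 * X 1 ^ 2 + C (X 3) * X 1 ^ 3 := by
  rw [cubic, genericForm, binaryForm_three]
  simp only [map_mul, map_ofNat]

theorem pderiv_ofNat {σ R : Type*} [CommRing R] (i : σ) (k : ℕ) [k.AtLeastTwo] :
    pderiv i (ofNat(k) : MvPolynomial σ R) = 0 := by
  rw [← map_ofNat C k, pderiv_C]

theorem pderiv_zero_cubic : pderiv 0 cubic =
    3 * (C (X 0) * X 0 ^ 2 + 2 * C (X 1) * X 0 * X 1 + C (X 2) * X 1 ^ 2) := by
  rw [cubic_eq]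
  simp [pderiv_X, pderiv_ofNat]
  ring

theorem pderiv_one_cubic : pderiv 1 cubic =
    3 * (C (X 1) * X 0 ^ 2 + 2 * C (X 2) * X 0 * X 1 + C (X 3) * X 1 ^ 2) := by
  rw [cubic_eq]
  simp [pderiv_X, pderiv_ofNat]
  ring

theorem hessian_eq : hessian = C (X 0 * X 2 - X 1 ^ 2) * X 0 ^ 2
    + C (X 0 * X 3 - X 1 * X 2) * X 0 * X 1 + C (X 1 * X 3 - X 2 ^ 2) * X 1 ^ 2 := by
  have h : pderiv 0 (pderiv 0 cubic) * pderiv 1 (pderiv 1 cubic) - pderiv 0 (pderiv 1 cubic) ^ 2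
      = (36 : ℂ) • (C (X 0 * X 2 - X 1 ^ 2) * X 0 ^ 2
    + C (X 0 * X 3 - X 1 * X 2) * X 0 * X 1 + C (X 1 * X 3 - X 2 ^ 2) * X 1 ^ 2 : FormRing 3) := by
    rw [pderiv_zero_cubic, pderiv_one_cubic, Algebra.smul_def, map_ofNat]
    simp [pderiv_X, pderiv_ofNat]
    ring
  rw [hessian, h, smul_smul]
  norm_num

theorem pderiv_zero_hessian : pderiv 0 hessian =
    2 * C (X 0 * X 2 - X 1 ^ 2) * X 0 + C (X 0 * X 3 - X 1 * X 2) * X 1 := by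
  rw [hessian_eq]
  simp [pderiv_X]
  ring

theorem pderiv_one_hessian : pderiv 1 hessian =
    C (X 0 * X 3 - X 1 * X 2) * X 0 + 2 * C (X 1 * X 3 - X 2 ^ 2) * X 1 := by
  rw [hessian_eq]
  simp [pderiv_X]
  ring

theorem covariantQ_eq :
    covariantQ = pderiv 0 cubic * pderiv 1 hessian - pderiv 1 cubic * pderiv 0 hessian := by
  simp [covariantQ, transvectant, Finset.sum_range_succ]
  ring

theorem covariant_relation :
    36 * hessian ^ 3 + 9 * discriminant * cubic ^ 2 + covariantQ ^ 2 = 0 := by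
  rw [covariantQ_eq, pderiv_zero_cubic, pderiv_one_cubic, pderiv_zero_hessian, pderiv_one_hessian,
    hessian_eq, cubic_eq, discriminant]
  simp only [map_mul, map_sub, map_pow, map_ofNat]
  ring

/-! ### Evaluation at a form and a vector -/

/-- The value of `Φ` at the cubic with coefficients `a` and the vector `v`. -/
noncomputable def evalAt (a : Fin 4 → ℂ) (v : Fin 2 → ℂ) : FormRing 3 →ₐ[ℂ] ℂ :=
  { (eval v).comp (specialize (d := 3) a) with
    commutes' := fun c => by
      simp [specialize, MvPolynomial.algebraMap_apply] }

theorem evalAt_apply (a : Fin 4 → ℂ) (v : Fin 2 → ℂ) (Φ : FormRing 3) :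
    evalAt a v Φ = eval v (specialize a Φ) := rfl

@[simp] theorem evalAt_C (a : Fin 4 → ℂ) (v : Fin 2 → ℂ) (p : MvPolynomial (Fin 4) ℂ) :
    evalAt a v (C p) = eval a p := by
  simp [evalAt_apply, specialize]

@[simp] theorem evalAt_X (a : Fin 4 → ℂ) (v : Fin 2 → ℂ) (i : Fin 2) :
    evalAt a v (X i) = v i := by
  simp [evalAt_apply, specialize]

@[simp] theorem evalAt_ofNat (a : Fin 4 → ℂ) (v : Fin 2 → ℂ) (k : ℕ) [k.AtLeastTwo] :
    evalAt a v (ofNat(k) : FormRing 3) = ofNat(k) :=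
  map_ofNat _ _

theorem eq_zero_of_evalAt {Φ : FormRing 3} (h : ∀ a v, evalAt a v Φ = 0) : Φ = 0 := by
  ext1 m
  refine MvPolynomial.funext fun a => ?_
  have : specialize a Φ = 0 := MvPolynomial.funext fun v => by
    rw [← evalAt_apply, h, map_zero]
  have := congrArg (coeff m) this
  rwa [specialize, coeff_map] at this

theorem evalAt_cubic (a : Fin 4 → ℂ) (v : Fin 2 → ℂ) : evalAt a v cubic =
    a 0 * v 0 ^ 3 + 3 * a 1 * v 0 ^ 2 * v 1 + 3 * a 2 * v 0 * v 1 ^ 2 + a 3 * v 1 ^ 3 := by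
  simp [cubic_eq]

theorem evalAt_hessian (a : Fin 4 → ℂ) (v : Fin 2 → ℂ) : evalAt a v hessian =
    (a 0 * a 2 - a 1 ^ 2) * v 0 ^ 2 + (a 0 * a 3 - a 1 * a 2) * v 0 * v 1
      + (a 1 * a 3 - a 2 ^ 2) * v 1 ^ 2 := by
  simp [hessian_eq]

theorem evalAt_discriminant (a : Fin 4 → ℂ) (v : Fin 2 → ℂ) : evalAt a v discriminant =
    4 * (a 0 * a 2 - a 1 ^ 2) * (a 1 * a 3 - a 2 ^ 2) - (a 0 * a 3 - a 1 * a 2) ^ 2 := by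
  simp [discriminant]

theorem evalAt_covariantQ (a : Fin 4 → ℂ) (v : Fin 2 → ℂ) : evalAt a v covariantQ =
    3 * (a 0 * v 0 ^ 2 + 2 * a 1 * v 0 * v 1 + a 2 * v 1 ^ 2)
        * ((a 0 * a 3 - a 1 * a 2) * v 0 + 2 * (a 1 * a 3 - a 2 ^ 2) * v 1)
      - 3 * (a 1 * v 0 ^ 2 + 2 * a 2 * v 0 * v 1 + a 3 * v 1 ^ 2)
        * (2 * (a 0 * a 2 - a 1 ^ 2) * v 0 + (a 0 * a 3 - a 1 * a 2) * v 1) := by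
  simp [covariantQ_eq, pderiv_zero_cubic, pderiv_one_cubic, pderiv_zero_hessian,
    pderiv_one_hessian]

/-! ### The action of `SL(2)` on coefficient vectors -/

/-- The coefficients of the cubic `f ∘ g`, where `f` has coefficients `a`. -/
def actCoeff (g : Matrix (Fin 2) (Fin 2) ℂ) (a : Fin 4 → ℂ) : Fin 4 → ℂ :=
  ![a 0 * g 0 0 ^ 3 + 3 * a 1 * g 0 0 ^ 2 * g 1 0 + 3 * a 2 * g 0 0 * g 1 0 ^ 2
      + a 3 * g 1 0 ^ 3,
    a 0 * g 0 0 ^ 2 * g 0 1 + a 1 * (2 * g 0 0 * g 0 1 * g 1 0 + g 0 0 ^ 2 * g 1 1)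
      + a 2 * (2 * g 0 0 * g 1 0 * g 1 1 + g 0 1 * g 1 0 ^ 2) + a 3 * g 1 0 ^ 2 * g 1 1,
    a 0 * g 0 0 * g 0 1 ^ 2 + a 1 * (2 * g 0 0 * g 0 1 * g 1 1 + g 0 1 ^ 2 * g 1 0)
      + a 2 * (2 * g 0 1 * g 1 0 * g 1 1 + g 0 0 * g 1 1 ^ 2) + a 3 * g 1 0 * g 1 1 ^ 2,
    a 0 * g 0 1 ^ 3 + 3 * a 1 * g 0 1 ^ 2 * g 1 1 + 3 * a 2 * g 0 1 * g 1 1 ^ 2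
      + a 3 * g 1 1 ^ 3]

theorem binaryForm_actCoeff (g : Matrix.SpecialLinearGroup (Fin 2) ℂ) (a : Fin 4 → ℂ) :
    binaryForm 3 (actCoeff g.1 a) = substitute g (binaryForm 3 a) := by
  refine MvPolynomial.funext fun v => ?_
  simp [binaryForm_three, actCoeff, substitute]
  ring

theorem binaryForm_three_injective :
    Function.Injective (binaryForm 3 : (Fin 4 → ℂ) → MvPolynomial (Fin 2) ℂ) := by
  intro a b h
  have key : ∀ x y : ℂ, eval ![x, y] (binaryForm 3 a) = eval ![x, y] (binaryForm 3 b) :=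
    fun x y => by rw [h]
  have e1 := key 1 0
  have e2 := key 0 1
  have e3 := key 1 1
  have e4 := key 1 (-1)
  simp [binaryForm_three] at e1 e2 e3 e4
  ext i
  fin_cases i
  · exact e1
  · change a 1 = b 1
    linear_combination (e3 - e4 - 2 * e2) / 6
  · change a 2 = b 2
    linear_combination (e3 + e4 - 2 * e1) / 6
  · exact e2

theorem eval_substitute (g : Matrix.SpecialLinearGroup (Fin 2) ℂ) (v : Fin 2 → ℂ)
    (F : MvPolynomial (Fin 2) ℂ) : eval v (substitute g F) = eval (g.1.mulVec v) F := by
  induction F using MvPolynomial.induction_on with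
  | C c => simp [substitute]
  | add p q hp hq => simp [hp, hq]
  | mul_X p i hp =>
    rw [map_mul, map_mul, hp, map_mul, eval_X]
    congr 1
    simp only [substitute, aeval_X, map_sum, map_mul, eval_C, eval_X, Matrix.mulVec, dotProduct]

/-- Since a form determines its coefficients, `b` must be `actCoeff g a`; equivariance becomes an
explicit identity between numbers. -/
theorem isEquivariant_iff {Φ : FormRing 3} : IsEquivariant Φ ↔
    ∀ (g : Matrix.SpecialLinearGroup (Fin 2) ℂ) (a : Fin 4 → ℂ) (v : Fin 2 → ℂ),
      evalAt (actCoeff g.1 a) v Φ = evalAt a (g.1.mulVec v) Φ := by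
  constructor
  · intro h g a v
    rw [evalAt_apply, h g a _ (binaryForm_actCoeff g a), eval_substitute, evalAt_apply]
  · intro h g a b hab
    obtain rfl : b = actCoeff g.1 a :=
      binaryForm_three_injective (hab.trans (binaryForm_actCoeff g a).symm)
    exact MvPolynomial.funext fun v => by
      rw [← evalAt_apply, h, eval_substitute, evalAt_apply]

theorem isEquivariant_cubic : IsEquivariant cubic := by
  rw [isEquivariant_iff]
  intro g a v
  simp only [evalAt_cubic, actCoeff, Matrix.mulVec, dotProduct, Fin.sum_univ_two]
  simp
  ring

theorem isEquivariant_hessian : IsEquivariant hessian := by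
  rw [isEquivariant_iff]
  intro g a v
  have hd := g.2
  rw [Matrix.det_fin_two] at hd
  -- With the weight factor `det ^ 2` the identity holds for all matrices, so `ring` proves it
  -- without using `det = 1`. `Q` and `Δ` below have weights 3 and 6.
  suffices h : evalAt (actCoeff g.1 a) v hessian = (g.1 0 0 * g.1 1 1 - g.1 0 1 * g.1 1 0) ^ 2
      * evalAt a (g.1.mulVec v) hessian by
    rwa [hd, one_pow, one_mul] at h
  simp only [evalAt_hessian, actCoeff, Matrix.mulVec, dotProduct, Fin.sum_univ_two]
  simp
  ring

theorem isEquivariant_covariantQ : IsEquivariant covariantQ := by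
  rw [isEquivariant_iff]
  intro g a v
  have hd := g.2
  rw [Matrix.det_fin_two] at hd
  suffices h : evalAt (actCoeff g.1 a) v covariantQ = (g.1 0 0 * g.1 1 1 - g.1 0 1 * g.1 1 0) ^ 3
      * evalAt a (g.1.mulVec v) covariantQ by
    rwa [hd, one_pow, one_mul] at h
  simp only [evalAt_covariantQ, actCoeff, Matrix.mulVec, dotProduct, Fin.sum_univ_two]
  simp
  ring

theorem isEquivariant_discriminant : IsEquivariant discriminant := by
  rw [isEquivariant_iff]
  intro g a v
  have hd := g.2
  rw [Matrix.det_fin_two] at hd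
  suffices h : evalAt (actCoeff g.1 a) v discriminant = (g.1 0 0 * g.1 1 1 - g.1 0 1 * g.1 1 0) ^ 6
      * evalAt a (g.1.mulVec v) discriminant by
    rwa [hd, one_pow, one_mul] at h
  simp only [evalAt_discriminant, actCoeff]
  simp
  ring

/-! ### Bihomogeneity -/

/-- `Φ` is homogeneous of degree `n` in the coefficients and of degree `e` in `x, y`. -/
def IsBihomogeneous (n e : ℕ) (Φ : FormRing 3) : Prop :=
  Φ.IsHomogeneous e ∧ ∀ m, (Φ.coeff m).IsHomogeneous n

namespace IsBihomogeneous

variable {n e n' e' : ℕ} {Φ Ψ : FormRing 3}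

theorem add (h : IsBihomogeneous n e Φ) (k : IsBihomogeneous n e Ψ) :
    IsBihomogeneous n e (Φ + Ψ) :=
  ⟨h.1.add k.1, fun m => by rw [coeff_add]; exact (h.2 m).add (k.2 m)⟩

theorem sub (h : IsBihomogeneous n e Φ) (k : IsBihomogeneous n e Ψ) :
    IsBihomogeneous n e (Φ - Ψ) :=
  ⟨h.1.sub k.1, fun m => by rw [coeff_sub]; exact (h.2 m).sub (k.2 m)⟩

theorem mul (h : IsBihomogeneous n e Φ) (k : IsBihomogeneous n' e' Ψ) :
    IsBihomogeneous (n + n') (e + e') (Φ * Ψ) :=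
  ⟨h.1.mul k.1, fun m => by
    rw [coeff_mul]
    exact IsHomogeneous.sum _ _ _ fun p _ => (h.2 p.1).mul (k.2 p.2)⟩

theorem of_C {p : MvPolynomial (Fin 4) ℂ} (h : p.IsHomogeneous n) :
    IsBihomogeneous n 0 (C p) :=
  ⟨isHomogeneous_C _ _, fun m => by
    rw [coeff_C]
    split_ifs
    exacts [h, isHomogeneous_zero _ _ _]⟩

theorem of_X (i : Fin 2) : IsBihomogeneous 0 1 (X i) :=
  ⟨isHomogeneous_X _ _, fun m => by
    rw [coeff_X]
    split_ifs
    exacts [isHomogeneous_one _ _, isHomogeneous_zero _ _ _]⟩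

theorem of_ofNat (k : ℕ) [k.AtLeastTwo] : IsBihomogeneous 0 0 (ofNat(k) : FormRing 3) := by
  rw [← map_ofNat C k, ← map_ofNat C k]
  exact of_C (isHomogeneous_C _ _)

end IsBihomogeneous

open IsBihomogeneous in
theorem isBihomogeneous_cubic : IsBihomogeneous 1 3 cubic := by
  have a (i : Fin 4) : IsBihomogeneous 1 0 (C (X i)) := of_C (isHomogeneous_X _ _)
  have x := of_X 0
  have y := of_X 1
  rw [cubic_eq]
  simp only [pow_succ, pow_zero, one_mul]
  exact ((((a 0).mul ((x.mul x).mul x)).add ((((of_ofNat 3).mul (a 1)).mul (x.mul x)).mul y)).add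
    ((((of_ofNat 3).mul (a 2)).mul x).mul (y.mul y))).add ((a 3).mul ((y.mul y).mul y))

theorem isHomogeneous_minor (i j k l : Fin 4) :
    (X i * X j - X k * X l : MvPolynomial (Fin 4) ℂ).IsHomogeneous 2 :=
  ((isHomogeneous_X _ _).mul (isHomogeneous_X _ _)).sub
    ((isHomogeneous_X _ _).mul (isHomogeneous_X _ _))

open IsBihomogeneous in
theorem isBihomogeneous_hessian : IsBihomogeneous 2 2 hessian := by
  have a (i j k l : Fin 4) := of_C (isHomogeneous_minor i j k l)
  have x := of_X 0
  have y := of_X 1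
  rw [hessian_eq]
  simp only [pow_succ, pow_zero, one_mul]
  exact (((a 0 2 1 1).mul (x.mul x)).add (((a 0 3 1 2).mul x).mul y)).add
    ((a 1 3 2 2).mul (y.mul y))

open IsBihomogeneous in
theorem isBihomogeneous_covariantQ : IsBihomogeneous 3 3 covariantQ := by
  have a (i : Fin 4) : IsBihomogeneous 1 0 (C (X i)) := of_C (isHomogeneous_X _ _)
  have b (i j k l : Fin 4) := of_C (isHomogeneous_minor i j k l)
  have x := of_X 0
  have y := of_X 1
  have t := of_ofNat 2
  have s (i j k : Fin 4) := (of_ofNat 3).mul ((((a i).mul (x.mul x)).add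
    (((t.mul (a j)).mul x).mul y)).add ((a k).mul (y.mul y)))
  rw [covariantQ_eq, pderiv_zero_cubic, pderiv_one_cubic, pderiv_zero_hessian, pderiv_one_hessian]
  simp only [pow_succ, pow_zero, one_mul]
  exact ((s 0 1 2).mul (((b 0 3 1 2).mul x).add ((t.mul (b 1 3 2 2)).mul y))).sub
    ((s 1 2 3).mul (((t.mul (b 0 2 1 1)).mul x).add ((b 0 3 1 2).mul y)))

open IsBihomogeneous in
theorem isBihomogeneous_discriminant : IsBihomogeneous 4 0 discriminant := by
  have b (i j k l : Fin 4) := of_C (isHomogeneous_minor i j k l)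
  rw [discriminant, map_sub, map_mul, map_mul, map_pow, map_ofNat]
  simp only [pow_succ, pow_zero, one_mul]
  exact (((of_ofNat 4).mul (b 0 2 1 1)).mul (b 1 3 2 2)).sub ((b 0 3 1 2).mul (b 0 3 1 2))

/-! ### Division by the relation -/

/-- The relation `36 T₁³ + 9 T₀ T₂² + T₃²`. -/
noncomputable def relation : MvPolynomial (Fin 4) ℂ := 36 * X 1 ^ 3 + 9 * X 0 * X 2 ^ 2 + X 3 ^ 2

theorem exists_division (P : MvPolynomial (Fin 4) ℂ) :
    ∃ (K : MvPolynomial (Fin 4) ℂ) (A B : MvPolynomial (Fin 3) ℂ),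
      P = relation * K + rename Fin.castSucc A + X 3 * rename Fin.castSucc B := by
  induction P using MvPolynomial.induction_on with
  | C c => exact ⟨0, C c, 0, by simp⟩
  | add p q hp hq =>
    obtain ⟨K, A, B, rfl⟩ := hp
    obtain ⟨K', A', B', rfl⟩ := hq
    exact ⟨K + K', A + A', B + B', by simp only [map_add]; ring⟩
  | mul_X p i hp =>
    obtain ⟨K, A, B, rfl⟩ := hp
    induction i using Fin.lastCases with
    | last =>
      -- Multiplication by `T₃` swaps the two remainders, and `T₃² B` is reduced by the relation.
      refine ⟨X 3 * K + rename Fin.castSucc B, -(36 * X 1 ^ 3 + 9 * X 0 * X 2 ^ 2) * B, A, ?_⟩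
      have e0 : Fin.castSucc (0 : Fin 3) = 0 := rfl
      have e1 : Fin.castSucc (1 : Fin 3) = 1 := rfl
      have e2 : Fin.castSucc (2 : Fin 3) = 2 := rfl
      have e3 : Fin.last 3 = 3 := rfl
      simp only [map_add, map_mul, map_neg, map_pow, rename_X, map_ofNat, relation, e0, e1, e2, e3]
      ring
    | cast i =>
      refine ⟨K * X i.castSucc, A * X i, B * X i, ?_⟩
      simp only [map_mul, rename_X]
      ring

/-- Density of the open set `B ≠ 0`: the product `A * B` vanishes everywhere. -/
theorem eq_zero_of_eval_mul {σ : Type*} {A B : MvPolynomial σ ℂ} (hB : B ≠ 0)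
    (h : ∀ x, eval x B ≠ 0 → eval x A = 0) : A = 0 := by
  have : A * B = 0 := MvPolynomial.funext fun x => by
    rw [map_mul, map_zero]
    by_cases hx : eval x B = 0
    · rw [hx, mul_zero]
    · rw [h x hx, zero_mul]
  exact (mul_eq_zero.mp this).resolve_right hB

theorem exists_sub_eq_X_mul {σ : Type*} [DecidableEq σ] (i : σ) (P : MvPolynomial σ ℂ) :
    ∃ R, P = aeval (Function.update X i 0) P + X i * R := by
  induction P using MvPolynomial.induction_on with
  | C c => exact ⟨0, by simp⟩
  | add p q hp hq =>
    obtain ⟨R, hR⟩ := hp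
    obtain ⟨R', hR'⟩ := hq
    exact ⟨R + R', by rw [map_add]; linear_combination hR + hR'⟩
  | mul_X p j hp =>
    obtain ⟨R, hR⟩ := hp
    rw [map_mul, aeval_X]
    by_cases hj : j = i
    · subst hj
      exact ⟨p, by rw [Function.update_self]; ring⟩
    · exact ⟨R * X j, by rw [Function.update_of_ne hj]; linear_combination X j * hR⟩

theorem X_dvd_of_eval_eq_zero {σ : Type*} [DecidableEq σ] (i : σ) {P : MvPolynomial σ ℂ}
    (h : ∀ x, x i = 0 → eval x P = 0) : X i ∣ P := by
  obtain ⟨R, hR⟩ := exists_sub_eq_X_mul i P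
  have h0 : aeval (Function.update X i 0) P = (0 : MvPolynomial σ ℂ) :=
    MvPolynomial.funext fun x => by
      have e : eval x (aeval (Function.update X i 0) P) = eval (Function.update x i 0) P := by
        rw [← aeval_eq_eval, ← aeval_eq_eval, ← AlgHom.comp_apply, comp_aeval]
        congr 2
        ext j
        by_cases hj : j = i
        · subst hj
          simp
        · simp [hj]
      rw [e, h _ (Function.update_self ..), map_zero]
  rw [h0, zero_add] at hR
  exact ⟨R, hR⟩

theorem eval_rename_castSucc (x : Fin 4 → ℂ) (A : MvPolynomial (Fin 3) ℂ) :
    eval x (rename Fin.castSucc A) = eval ![x 0, x 1, x 2] A := by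
  rw [eval_rename]
  congr 2
  ext i
  fin_cases i <;> rfl

theorem eval_relation (d h t q : ℂ) :
    eval ![d, h, t, q] relation = 36 * h ^ 3 + 9 * d * t ^ 2 + q ^ 2 := by
  simp [relation]

/-- If `P` vanishes on a fibre of the hypersurface `relation = 0` over `(d, h, t)`, then so do the
two components of the remainder, provided that the fibre has two points. -/
theorem eval_remainder_eq_zero {P K : MvPolynomial (Fin 4) ℂ} {A B : MvPolynomial (Fin 3) ℂ}
    (hP : P = relation * K + rename Fin.castSucc A + X 3 * rename Fin.castSucc B) {d h t : ℂ}
    (h0 : 36 * h ^ 3 + 9 * d * t ^ 2 ≠ 0)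
    (hv : ∀ q, 36 * h ^ 3 + 9 * d * t ^ 2 + q ^ 2 = 0 → eval ![d, h, t, q] P = 0) :
    eval ![d, h, t] A = 0 ∧ eval ![d, h, t] B = 0 := by
  obtain ⟨q, hq⟩ := IsAlgClosed.exists_pow_nat_eq (-(36 * h ^ 3 + 9 * d * t ^ 2)) two_pos
  have hq0 : q ≠ 0 := by
    rintro rfl
    apply h0
    linear_combination hq
  have key : ∀ r : ℂ, r ^ 2 = q ^ 2 → eval ![d, h, t] A + r * eval ![d, h, t] B = 0 := by
    intro r hr
    have hrel : 36 * h ^ 3 + 9 * d * t ^ 2 + r ^ 2 = 0 := by rw [hr, hq]; ring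
    have := hv r hrel
    rw [hP] at this
    simpa [eval_relation, hrel, eval_rename_castSucc] using this
  have e1 := key q rfl
  have e2 := key (-q) (by ring)
  refine ⟨by linear_combination (e1 + e2) / 2, ?_⟩
  have : q * eval ![d, h, t] B = 0 := by linear_combination (e1 - e2) / 2
  exact (mul_eq_zero.mp this).resolve_left hq0

theorem relation_lower_ne_zero : (36 * X 1 ^ 3 + 9 * X 0 * X 2 ^ 2 : MvPolynomial (Fin 3) ℂ) ≠ 0 :=
  fun h => by simpa using congrArg (eval ![0, 1, 0]) h

/-! ### The source of a covariant -/

/-- The sources of `Δ`, `H`, `f`, `Q`, as functions of the coefficients. -/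
def sourceValue (a : Fin 4 → ℂ) : Fin 4 → ℂ :=
  ![4 * (a 0 * a 2 - a 1 ^ 2) * (a 1 * a 3 - a 2 ^ 2) - (a 0 * a 3 - a 1 * a 2) ^ 2,
    a 0 * a 2 - a 1 ^ 2, a 0, 3 * (a 0 ^ 2 * a 3 - 3 * a 0 * a 1 * a 2 + 2 * a 1 ^ 3)]

/-- The homomorphism `T₀ ↦ Δ`, `T₁ ↦ H`, `T₂ ↦ f`, `T₃ ↦ Q`. -/
noncomputable def presentation : MvPolynomial (Fin 4) ℂ →ₐ[ℂ] FormRing 3 :=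
  aeval ![discriminant, hessian, cubic, covariantQ]

theorem evalAt_presentation (a : Fin 4 → ℂ) (P : MvPolynomial (Fin 4) ℂ) :
    evalAt a ![1, 0] (presentation P) = eval (sourceValue a) P := by
  rw [presentation, ← AlgHom.comp_apply, comp_aeval, ← coe_aeval_eq_eval]
  have : (fun i => evalAt a ![1, 0] (![discriminant, hessian, cubic, covariantQ] i))
      = sourceValue a := by
    ext i
    fin_cases i
    · simp [evalAt_discriminant, sourceValue]
    · simp [evalAt_hessian, sourceValue]
    · simp [evalAt_cubic, sourceValue]
    · simp [evalAt_covariantQ, sourceValue]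
      ring
  rw [this]
  rfl

theorem exists_sourceValue_eq {d h t q : ℂ} (ht : t ≠ 0)
    (hr : 36 * h ^ 3 + 9 * d * t ^ 2 + q ^ 2 = 0) : ∃ a, sourceValue a = ![d, h, t, q] := by
  -- The cubic with `a₁ = 0`: the values of `f`, `H`, `Q` fix `a₀`, `a₂`, `a₃`, and the relation
  -- then forces `Δ = d`.
  refine ⟨![t, 0, h / t, q / (3 * t ^ 2)], ?_⟩
  ext i
  fin_cases i
  · simp [sourceValue]
    field_simp
    linear_combination -hr
  · simp [sourceValue]
    field_simp
  · simp [sourceValue]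
  · simp [sourceValue]
    field_simp

theorem exists_sourceValue_eq_of_zero {d h q : ℂ} (hh : h ≠ 0) (hr : 36 * h ^ 3 + q ^ 2 = 0) :
    ∃ a, a 0 = 0 ∧ sourceValue a = ![d, h, 0, q] := by
  have hq : q ≠ 0 := by
    rintro rfl
    simp [hh] at hr
  -- For `a₀ = a₂ = 0` the sources are `h = -a₁²`, `q = 6 a₁³`, `d = -4 a₁³ a₃`; solve for `a₁`,
  -- then `a₃`.
  refine ⟨![0, -q / (6 * h), 0, -d / (4 * (-q / (6 * h)) ^ 3)], rfl, ?_⟩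
  ext i
  fin_cases i
  · simp [sourceValue]
    field_simp
  · simp [sourceValue]
    field_simp
    linear_combination -hr
  · simp [sourceValue]
  · simp [sourceValue]
    field_simp
    linear_combination -6 * hr

/-! ### The ideal of relations -/

theorem ker_presentation : RingHom.ker presentation = Ideal.span {relation} := by
  refine le_antisymm (fun P hP => ?_) ?_
  · rw [RingHom.mem_ker] at hP
    obtain ⟨K, A, B, hdiv⟩ := exists_division P
    have hz : ∀ x : Fin 3 → ℂ,
        eval x (X 2 * (36 * X 1 ^ 3 + 9 * X 0 * X 2 ^ 2) : MvPolynomial (Fin 3) ℂ) ≠ 0 →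
          eval x A = 0 ∧ eval x B = 0 := by
      intro x hx
      obtain ⟨ht, h0⟩ : x 2 ≠ 0 ∧ 36 * x 1 ^ 3 + 9 * x 0 * x 2 ^ 2 ≠ 0 := by
        simpa only [map_mul, map_add, map_pow, eval_X, map_ofNat, mul_ne_zero_iff] using hx
      have hxe : x = ![x 0, x 1, x 2] := by
        ext i
        fin_cases i <;> rfl
      rw [hxe]
      refine eval_remainder_eq_zero hdiv h0 fun q hq => ?_
      obtain ⟨a, ha⟩ := exists_sourceValue_eq ht hq
      rw [← ha, ← evalAt_presentation, hP, map_zero]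
    have hne := mul_ne_zero (X_ne_zero (R := ℂ) (2 : Fin 3)) relation_lower_ne_zero
    have hA := eq_zero_of_eval_mul hne fun x hx => (hz x hx).1
    have hB := eq_zero_of_eval_mul hne fun x hx => (hz x hx).2
    rw [hdiv, hA, hB, map_zero, mul_zero, add_zero, add_zero]
    exact Ideal.mul_mem_right _ _ (Ideal.mem_span_singleton_self _)
  · rw [Ideal.span_singleton_le_iff_mem, RingHom.mem_ker]
    simpa [presentation, relation] using covariant_relation

/-! ### Clearing and cancelling powers of `a₀` in the source -/

theorem eval_sourceValue_relation (a : Fin 4 → ℂ) : eval (sourceValue a) relation = 0 := by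
  simp [relation, sourceValue]
  ring

theorem eval_source (a : Fin 4 → ℂ) (Φ : FormRing 3) :
    eval a (eval ![1, 0] Φ) = evalAt a ![1, 0] Φ := by
  induction Φ using MvPolynomial.induction_on with
  | C p => simp
  | add p q hp hq => simp only [map_add, hp, hq]
  | mul_X p i hp =>
    rw [map_mul, map_mul, hp, map_mul, evalAt_X, eval_X]
    congr 1
    fin_cases i <;> simp

/-- The right-hand side is itself polynomial in `a`, being the source of `presentation P`, so `a₀`
cancels even at points with `a 0 = 0`. -/
theorem eval_eq_of_mul_eval {S P : MvPolynomial (Fin 4) ℂ}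
    (h : ∀ a, a 0 * eval a S = a 0 * eval (sourceValue a) P) (a : Fin 4 → ℂ) :
    eval a S = eval (sourceValue a) P := by
  rw [← evalAt_presentation, ← eval_source]
  congr 1
  refine sub_eq_zero.mp (eq_zero_of_eval_mul (X_ne_zero (0 : Fin 4)) fun x hx => ?_)
  rw [map_sub, eval_source, evalAt_presentation, sub_eq_zero]
  rw [eval_X] at hx
  exact mul_left_cancel₀ hx (h x)

/-- If the source of `P(Δ, H, f, Q)` is divisible by `a₀`, the quotient is again of this form. -/
theorem exists_eval_sourceValue_of_mul {S P : MvPolynomial (Fin 4) ℂ}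
    (h : ∀ a, a 0 * eval a S = eval (sourceValue a) P) :
    ∃ P' : MvPolynomial (Fin 4) ℂ, ∀ a, eval a S = eval (sourceValue a) P' := by
  obtain ⟨K, A, B, hdiv⟩ := exists_division P
  have hz : ∀ d k : ℂ, k ≠ 0 → eval ![d, k, 0] A = 0 ∧ eval ![d, k, 0] B = 0 := by
    intro d k hk
    refine eval_remainder_eq_zero hdiv (by simpa using hk) fun q hq => ?_
    obtain ⟨a, ha0, ha⟩ := exists_sourceValue_eq_of_zero (d := d) hk (by simpa using hq)
    rw [← ha, ← h, ha0, zero_mul]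
  have hdvd : ∀ D : MvPolynomial (Fin 3) ℂ, (∀ d k : ℂ, k ≠ 0 → eval ![d, k, 0] D = 0) →
      X 2 ∣ D := by
    intro D hD
    -- The factor `X 1` covers the points with `k = 0`; it drops out since `X 2` is prime and does
    -- not divide it.
    have : X 2 ∣ D * X 1 := X_dvd_of_eval_eq_zero 2 fun x hx => by
      rw [map_mul, eval_X]
      by_cases hx1 : x 1 = 0
      · rw [hx1, mul_zero]
      · have hxe : x = ![x 0, x 1, 0] := by
          ext i
          fin_cases i
          exacts [rfl, rfl, hx]
        rw [hxe, hD _ _ hx1, zero_mul]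
    refine ((X_prime (R := ℂ) (i := (2 : Fin 3))).dvd_or_dvd this).resolve_right ?_
    rw [X_dvd_X]
    simp
  obtain ⟨A', rfl⟩ := hdvd A fun d k hk => (hz d k hk).1
  obtain ⟨B', rfl⟩ := hdvd B fun d k hk => (hz d k hk).2
  set P' := rename Fin.castSucc A' + X 3 * rename Fin.castSucc B' with hP'
  refine ⟨P', eval_eq_of_mul_eval fun a => ?_⟩
  have e2 : Fin.castSucc (2 : Fin 3) = 2 := rfl
  have e0 : sourceValue a 2 = a 0 := rfl
  rw [h, hdiv, hP']
  simp only [map_add, map_mul, rename_X, eval_X, e2, e0, eval_sourceValue_relation]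
  ring

/-- Clears the denominators of the normal form with `a₁ = 0`. The arbitrary `d` is harmless, as the
constructed `P` does not involve `T₀`. -/
theorem exists_pow_mul_eval_eq (S : MvPolynomial (Fin 4) ℂ) :
    ∃ (k : ℕ) (P : MvPolynomial (Fin 4) ℂ), ∀ t h q : ℂ, t ≠ 0 → ∀ d,
      t ^ k * eval ![t, 0, h / t, q / (3 * t ^ 2)] S = eval ![d, h, t, q] P := by
  induction S using MvPolynomial.induction_on with
  | C c => exact ⟨0, C c, by simp⟩
  | add S S' hS hS' =>
    obtain ⟨k, P, hP⟩ := hS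
    obtain ⟨k', P', hP'⟩ := hS'
    refine ⟨k + k', X 2 ^ k' * P + X 2 ^ k * P', fun t h q ht d => ?_⟩
    simp only [map_add, map_mul, map_pow, eval_X, ← hP t h q ht d, ← hP' t h q ht d]
    simp
    ring
  | mul_X S i hS =>
    obtain ⟨k, P, hP⟩ := hS
    refine ⟨k + 2, P * ![X 2 ^ 3, 0, X 1 * X 2, C (1 / 3) * X 3] i, fun t h q ht d => ?_⟩
    rw [map_mul, map_mul, ← hP t h q ht d, eval_X, pow_add]
    have : t ^ 2 * ![t, 0, h / t, q / (3 * t ^ 2)] i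
        = eval ![d, h, t, q] (![X 2 ^ 3, 0, X 1 * X 2, C (1 / 3) * X 3] i) := by
      fin_cases i
      · simp
        ring
      · simp
      · simp
        field_simp
      · simp
        field_simp
    rw [← this]
    ring

/-- The matrix of a unipotent substitution `x ↦ x + s y`. -/
def shear (s : ℂ) : Matrix.SpecialLinearGroup (Fin 2) ℂ :=
  ⟨!![1, s; 0, 1], by simp⟩

/-- The source of an equivariant `Φ` is a polynomial in the sources of `Δ`, `H`, `f`, `Q`. -/
theorem exists_source_eq {Φ : FormRing 3} (hΦ : IsEquivariant Φ) :
    ∃ P : MvPolynomial (Fin 4) ℂ, ∀ a, evalAt a ![1, 0] Φ = eval (sourceValue a) P := by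
  rw [isEquivariant_iff] at hΦ
  -- The shear with `s = -a₁ / a₀` fixes `(1, 0)` and removes the `x²y` term.
  have hn : ∀ a : Fin 4 → ℂ, a 0 ≠ 0 → evalAt a ![1, 0] Φ =
      evalAt ![a 0, 0, sourceValue a 1 / a 0, sourceValue a 3 / (3 * a 0 ^ 2)] ![1, 0] Φ := by
    intro a ha
    have h1 : (shear (-a 1 / a 0)).1.mulVec ![1, 0] = ![1, 0] := by
      ext i
      fin_cases i <;> simp [shear]
    have h2 : actCoeff (shear (-a 1 / a 0)).1 a =
        ![a 0, 0, sourceValue a 1 / a 0, sourceValue a 3 / (3 * a 0 ^ 2)] := by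
      ext i
      fin_cases i
      · simp [actCoeff, shear]
      · simp [actCoeff, shear]
        field_simp
        ring
      · simp [actCoeff, shear, sourceValue]
        field_simp
        ring
      · simp [actCoeff, shear, sourceValue]
        field_simp
        ring
    rw [← h2, hΦ, h1]
  obtain ⟨k, P, hP⟩ := exists_pow_mul_eval_eq (eval ![1, 0] Φ)
  have hk : ∀ a, a 0 ^ k * eval a (eval ![1, 0] Φ) = eval (sourceValue a) P := by
    have := fun a => eval_eq_of_mul_eval (S := X 0 ^ k * eval ![1, 0] Φ) (P := P) (fun a => ?_) a
    · simpa only [map_mul, map_pow, eval_X] using this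
    · by_cases ha : a 0 = 0
      · rw [ha, zero_mul, zero_mul]
      · rw [map_mul, map_pow, eval_X, eval_source, hn a ha, ← eval_source, hP _ _ _ ha
          (sourceValue a 0)]
        rfl
  simp only [← eval_source]
  generalize eval ![1, 0] Φ = S at hk
  clear hP
  induction k generalizing P with
  | zero => exact ⟨P, by simpa using hk⟩
  | succ k ih =>
    obtain ⟨P', hP'⟩ := exists_eval_sourceValue_of_mul (S := X 0 ^ k * S) (P := P) fun a => by
      rw [← hk, map_mul, map_pow, eval_X]
      ring
    exact ih P' fun a => by rw [← hP', map_mul, map_pow, eval_X]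

/-- An equivariant `Φ` is determined by its source. -/
theorem IsEquivariant.eq_of_source_eq {Φ Ψ : FormRing 3} (hΦ : IsEquivariant Φ)
    (hΨ : IsEquivariant Ψ) (h : ∀ a, evalAt a ![1, 0] Φ = evalAt a ![1, 0] Ψ) : Φ = Ψ := by
  rw [isEquivariant_iff] at hΦ hΨ
  have key : ∀ a v, v 0 ≠ 0 → evalAt a v Φ = evalAt a v Ψ := by
    intro a v hv
    -- A matrix of determinant 1 with first column `v`.
    let g : Matrix.SpecialLinearGroup (Fin 2) ℂ := ⟨!![v 0, 0; v 1, (v 0)⁻¹], by simp [hv]⟩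
    have hg : v = g.1.mulVec ![1, 0] := by
      ext i
      fin_cases i <;> simp [g]
    rw [hg, ← hΦ, ← hΨ, h]
  refine sub_eq_zero.mp ((mul_eq_zero.mp (eq_zero_of_evalAt (Φ := X 0 * (Φ - Ψ)) fun a v => ?_)
    ).resolve_left (X_ne_zero _))
  rw [map_mul, map_sub, evalAt_X]
  by_cases hv : v 0 = 0
  · rw [hv, zero_mul]
  · rw [key a v hv, sub_self, mul_zero]

/-! ### Generation of the algebra of covariants -/

theorem isEquivariant_of_mem {Φ : FormRing 3} (h : Φ ∈ covariantAlgebra 3) : IsEquivariant Φ := by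
  change Φ ∈ (⨆ p : ℕ × ℕ, covariants 3 p.1 p.2) at h
  induction h using Submodule.iSup_induction' with
  | mem p Φ hΦ => exact hΦ.2.2
  | zero => exact fun g a b _ => by simp
  | add Φ Ψ _ _ hΦ hΨ =>
    exact fun g a b h => by rw [map_add, map_add, map_add, hΦ g a b h, hΨ g a b h]

theorem mem_covariantAlgebra {n e : ℕ} {Φ : FormRing 3} (h : IsBihomogeneous n e Φ)
    (h' : IsEquivariant Φ) : Φ ∈ covariantAlgebra 3 :=
  Submodule.mem_iSup_of_mem (p := fun p : ℕ × ℕ => covariants 3 p.1 p.2) (n, e) ⟨h.1, h.2, h'⟩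

theorem adjoin_eq_range_presentation :
    Algebra.adjoin ℂ {discriminant, hessian, cubic, covariantQ} = presentation.range := by
  rw [presentation, ← Algebra.adjoin_range_eq_range_aeval]
  congr 1
  simp only [Matrix.range_cons, Matrix.range_empty, Set.union_empty, Set.singleton_union]

theorem adjoin_eq_covariantAlgebra :
    Algebra.adjoin ℂ {discriminant, hessian, cubic, covariantQ} = covariantAlgebra 3 := by
  have hle : Algebra.adjoin ℂ {discriminant, hessian, cubic, covariantQ} ≤ covariantAlgebra 3 := by
    rw [Algebra.adjoin_le_iff]
    rintro Φ (rfl | rfl | rfl | rfl)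
    · exact mem_covariantAlgebra isBihomogeneous_discriminant isEquivariant_discriminant
    · exact mem_covariantAlgebra isBihomogeneous_hessian isEquivariant_hessian
    · exact mem_covariantAlgebra isBihomogeneous_cubic isEquivariant_cubic
    · exact mem_covariantAlgebra isBihomogeneous_covariantQ isEquivariant_covariantQ
  refine le_antisymm hle fun Φ hΦ => ?_
  have hΦ' := isEquivariant_of_mem hΦ
  obtain ⟨P, hP⟩ := exists_source_eq hΦ'
  rw [adjoin_eq_range_presentation] at hle ⊢
  refine ⟨P, (hΦ'.eq_of_source_eq (isEquivariant_of_mem (hle ⟨P, rfl⟩)) fun a => ?_).symm⟩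
  exact (hP a).trans (evalAt_presentation a P).symm

end BinaryCovariant

theorem mainTheorem5 :
    Algebra.adjoin ℂ {BinaryCovariant.discriminant, BinaryCovariant.hessian,
        BinaryCovariant.cubic, BinaryCovariant.covariantQ}
      = BinaryCovariant.covariantAlgebra 3 ∧
    36 * BinaryCovariant.hessian ^ 3
        + 9 * BinaryCovariant.discriminant * BinaryCovariant.cubic ^ 2
        + BinaryCovariant.covariantQ ^ 2 = 0 ∧
    RingHom.ker (MvPolynomial.aeval ![BinaryCovariant.discriminant, BinaryCovariant.hessian,
        BinaryCovariant.cubic, BinaryCovariant.covariantQ] :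
          MvPolynomial (Fin 4) ℂ →ₐ[ℂ] BinaryCovariant.FormRing 3)
      = Ideal.span {36 * MvPolynomial.X 1 ^ 3
          + 9 * MvPolynomial.X 0 * MvPolynomial.X 2 ^ 2 + MvPolynomial.X 3 ^ 2} := by
  exact ⟨BinaryCovariant.adjoin_eq_covariantAlgebra, BinaryCovariant.covariant_relation,
    BinaryCovariant.ker_presentation⟩
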